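/- Let $k,m\ge 0$ be integers and let $\lambda=(\lambda_1\ge\lambda_2\ge\cdots)$ be a partition with $\ell(\lambda)$ nonzero parts. Let $x_1,x_2,\dots$ and $y_1,y_2,\dots$ be indeterminates. *Double Schur polynomials.* For $i\ge 1$ and $1\le j\le k$ put $$Z_{ij}=\frac{\prod_{1\le b<i}(x_j+y_b)}{\prod_{1\le a<j}(x_j-x_a)}.$$ If $\ell(\lambda)\le k$, let $I(\lambda)=\{\lambda_k+1<\lambda_{k-1}+2<\cdots<\lambda_1+k\}$; the double Schur polynomial is $$s_\lambda(x_1,\dots,x_k\,|\,y)=\det(Z_{ij})_{i\in I(\lambda),\,1\le j\le k},$$ which is a polynomial in the $x$ and $y$ variables with integer coefficients. If $\ell(\lambda)>k$, set $s_\lambda(x_1,\dots,x_k\,|\,y)=0$. *Super-Schur polynomials.* The super-Schur function is the formal power series $$s_\lambda(x_1,x_2,\dots;y_1,y_2,\dots)=\sum_{T}\ \prod_{s\in\lambda}\bigl(x_{T(s)}+y_{T(s)+C(s)}\bigr),$$ where $T$ runs over all semistandard Young tableaux of shape $\lambda$ with positive integer entries, $s$ runs over the boxes of the Young diagram of $\lambda$,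 $T(s)$ is the entry of $T$ in the box $s$, and $C(s)=j-i$ for the box $s$ in row $i$ and column $j$. The super-Schur polynomial $s_\lambda(x_1,\dots,x_k;y_1,\dots,y_m)$ is its specialization at $x_{k+1}=x_{k+2}=\cdots=y_{m+1}=y_{m+2}=\cdots=0$. **Proposition.** If $m+\ell(\lambda)\le k+1$, then $$s_\lambda(x_1,\dots,x_k;y_1,\dots,y_m)=s_\lambda(x_1,\dots,x_k\,|\,y)\bigr|_{y_{m+1}=y_{m+2}=\cdots=0}.$$ -/

import Mathlib

/-!
# Double Schur polynomials and super-Schur functions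

A partition `λ` is a `YoungDiagram`, with parts `λ_{i+1} = lam.rowLen i` and length
`ℓ(λ) = lam.colLen 0`.  All indices are shifted to start at `0`: the variable `x_{i+1}` is
`X (Sum.inl i)` and the variable `y_{b+1}` is `X (Sum.inr b)`.
-/

namespace SchurVariations

noncomputable section

open scoped BigOperators

/-- The number of nonzero parts of a partition. -/
def length (lam : YoungDiagram) : ℕ := lam.colLen 0

/-! ### Double Schur polynomials -/

/-- The ring `ℤ[x_1, …, x_k; y_1, y_2, …]`. -/
abbrev DoubleRing (k : ℕ) : Type := MvPolynomial (Fin k ⊕ ℕ) ℤ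

/-- The numerator `∏_{1 ≤ b < i} (x_j + y_b)` of the `(i, j)` entry of the matrix `Z`; here the
row index `i` is `row + 1`. -/
def zNumerator (k : ℕ) (row : ℕ) (j : Fin k) : DoubleRing k :=
  ∏ b ∈ Finset.range row, (MvPolynomial.X (Sum.inl j) + MvPolynomial.X (Sum.inr b))

/-- The denominator `∏_{1 ≤ a < j} (x_j - x_a)` of the entries of the `j`-th column of `Z`. -/
def zDenominator (k : ℕ) (j : Fin k) : DoubleRing k :=
  ∏ a ∈ Finset.Iio j, (MvPolynomial.X (Sum.inl j) - MvPolynomial.X (Sum.inl a))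

/-- The first `k` columns of the matrix
`Z_{ij} = ∏_{1 ≤ b < i} (x_j + y_b) / ∏_{1 ≤ a < j} (x_j - x_a)`, over the field of rational
functions in the `x`'s and the `y`'s. -/
def zMatrix (k : ℕ) : Matrix ℕ (Fin k) (FractionRing (DoubleRing k)) :=
  Matrix.of fun row j =>
    algebraMap (DoubleRing k) (FractionRing (DoubleRing k)) (zNumerator k row j) /
      algebraMap (DoubleRing k) (FractionRing (DoubleRing k)) (zDenominator k j)

/-- The elements of `I(λ) = {λ_k + 1 < λ_{k-1} + 2 < ⋯ < λ_1 + k}`, listed in increasing order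
(and lowered by `1`, since rows are numbered from `0`). -/
def rowIndex (k : ℕ) (lam : YoungDiagram) (r : Fin k) : ℕ := lam.rowLen (Fin.rev r) + r

/-- The flag minor `det (Z_{ij})_{i ∈ I(λ), j ≤ k}`, a priori a rational function. -/
def flagMinor (k : ℕ) (lam : YoungDiagram) : FractionRing (DoubleRing k) :=
  ((zMatrix k).submatrix (rowIndex k lam) id).det

/-- A determinant `det (f_i(v_j))` with polynomials `f_i` is divisible by the Vandermonde
product. -/
theorem prod_sub_dvd_det {R : Type*} [CommRing R] (n : ℕ) (f : Fin n → Polynomial R)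
    (v : Fin n → R) :
    (∏ j : Fin n, ∏ a ∈ Finset.Iio j, (v j - v a)) ∣
      (Matrix.of fun i j => (f i).eval (v j)).det := by
  induction n with
  | zero => simp
  | succ n ih =>
    have hdiv : ∀ i, ∃ g : Polynomial R,
        f i - Polynomial.C ((f i).eval (v 0)) = (Polynomial.X - Polynomial.C (v 0)) * g := by
      intro i
      exact Polynomial.X_sub_C_dvd_sub_C_eval
    choose g hg using hdiv
    have hg' : ∀ i t, (f i).eval t = (f i).eval (v 0) + (t - v 0) * (g i).eval t := by
      intro i t
      have := congrArg (Polynomial.eval t) (hg i)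
      simp only [Polynomial.eval_sub, Polynomial.eval_C, Polynomial.eval_mul,
        Polynomial.eval_X] at this
      rw [← this]; ring
    have h1 : (Matrix.of fun i j => (f i).eval (v j)).det =
        (Matrix.of fun i (j : Fin (n + 1)) => Fin.cases (motive := fun _ => R) ((f i).eval (v 0))
          (fun j' => (v j'.succ - v 0) * (g i).eval (v j'.succ)) j).det := by
      rw [← Matrix.det_transpose, ← Matrix.det_transpose (Matrix.of fun i (j : Fin (n + 1)) =>
        Fin.cases (motive := fun _ => R) ((f i).eval (v 0))
          (fun j' => (v j'.succ - v 0) * (g i).eval (v j'.succ)) j)]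
      refine Matrix.det_eq_of_forall_row_eq_smul_add_const (fun j => if j = 0 then 0 else 1) 0
        (by simp) ?_
      intro j i
      refine Fin.cases ?_ (fun j' => ?_) j
      · simp
      · simp only [Matrix.transpose_apply, Matrix.of_apply, Fin.cases_succ, Fin.succ_ne_zero,
          if_false, one_mul, Fin.cases_zero]
        rw [hg' i (v j'.succ)]; ring
    rw [h1, Matrix.det_succ_column_zero]
    refine Finset.dvd_sum fun i _ => Dvd.dvd.mul_left ?_ _
    have h2 : ((Matrix.of fun i (j : Fin (n + 1)) => Fin.cases (motive := fun _ => R)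
          ((f i).eval (v 0)) (fun j' => (v j'.succ - v 0) * (g i).eval (v j'.succ)) j).submatrix
            i.succAbove Fin.succ) =
        Matrix.of fun i' j' => (v (Fin.succ j') - v 0) *
          (Matrix.of fun i'' j'' => (g (i.succAbove i'')).eval (v (Fin.succ j''))) i' j' := by
      ext a b; simp
    rw [h2, Matrix.det_mul_row]
    have h3 : (∏ j : Fin (n + 1), ∏ a ∈ Finset.Iio j, (v j - v a)) =
        (∏ j : Fin n, (v j.succ - v 0)) *
          ∏ j : Fin n, ∏ a ∈ Finset.Iio j, (v j.succ - v a.succ) := by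
      rw [Fin.prod_univ_succ, ← Finset.prod_mul_distrib]
      have h0 : Finset.Iio (0 : Fin (n + 1)) = ∅ := by ext a; simp
      rw [h0, Finset.prod_empty, one_mul]
      refine Finset.prod_congr rfl fun j _ => ?_
      have h4 : Finset.Iio j.succ = insert 0 ((Finset.Iio j).map (Fin.succEmb n)) := by
        ext a
        refine Fin.cases ?_ (fun a' => ?_) a
        · simp
        · simp
      rw [h4, Finset.prod_insert (by simp), Finset.prod_map]
      rfl
    rw [h3]
    exact mul_dvd_mul_left _ (ih _ _)

theorem zDenominator_ne_zero (k : ℕ) (j : Fin k) : zDenominator k j ≠ 0 := by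
  refine Finset.prod_ne_zero_iff.mpr fun a ha => ?_
  rw [sub_ne_zero]
  intro h
  have h' := Sum.inl_injective (MvPolynomial.X_injective h)
  rw [h'] at ha
  simp at ha

/-- The flag minors of `Z` are polynomials. -/
theorem exists_polynomial_eq_flagMinor (k : ℕ) (lam : YoungDiagram) :
    ∃ P : DoubleRing k,
      algebraMap (DoubleRing k) (FractionRing (DoubleRing k)) P = flagMinor k lam := by
  obtain ⟨P, hP⟩ := prod_sub_dvd_det k
    (fun r => ∏ b ∈ Finset.range (rowIndex k lam r),
      (Polynomial.X + Polynomial.C (MvPolynomial.X (Sum.inr b) : DoubleRing k)))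
    (fun j => MvPolynomial.X (Sum.inl j))
  refine ⟨P, ?_⟩
  have h1 : flagMinor k lam = (Matrix.of fun (r j : Fin k) =>
      (algebraMap (DoubleRing k) (FractionRing (DoubleRing k)) (zDenominator k j))⁻¹ *
      ((algebraMap (DoubleRing k) (FractionRing (DoubleRing k))).mapMatrix
        (Matrix.of fun (r j : Fin k) => zNumerator k (rowIndex k lam r) j)) r j).det := by
    unfold flagMinor
    congr 1
    ext r j
    simp [zMatrix, div_eq_inv_mul]
  have h2 : (Matrix.of fun (r j : Fin k) => zNumerator k (rowIndex k lam r) j).det =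
      (∏ j : Fin k, zDenominator k j) * P := by
    refine Eq.trans ?_ hP
    congr 1
    ext1 r j
    simp [zNumerator, Polynomial.eval_prod]
  have hne : algebraMap (DoubleRing k) (FractionRing (DoubleRing k))
      (∏ j : Fin k, zDenominator k j) ≠ 0 := by
    rw [Ne, FaithfulSMul.algebraMap_eq_zero_iff]
    exact Finset.prod_ne_zero_iff.mpr fun j _ => zDenominator_ne_zero k j
  rw [h1, Matrix.det_mul_row, ← RingHom.map_det, h2, map_mul, Finset.prod_inv_distrib, ← map_prod,
    inv_mul_cancel_left₀ hne]

open Classical in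
/-- The double Schur polynomial `s_λ(x_1, …, x_k | y)`: for a partition with at most `k` parts,
the polynomial equal to the flag minor `det (Z_{ij})_{i ∈ I(λ), j ≤ k}`; and `0` if `λ` has more
than `k` parts. -/
def doubleSchur (k : ℕ) (lam : YoungDiagram) : DoubleRing k :=
  if length lam ≤ k then (exists_polynomial_eq_flagMinor k lam).choose else 0

/-- The double Schur polynomial is the flag minor of `Z` (and this determines it, the map to the
field of fractions being injective). -/
theorem algebraMap_doubleSchur (k : ℕ) (lam : YoungDiagram) (h : length lam ≤ k) :
    algebraMap (DoubleRing k) (FractionRing (DoubleRing k)) (doubleSchur k lam) =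
      flagMinor k lam := by
  rw [doubleSchur, if_pos h]
  exact (exists_polynomial_eq_flagMinor k lam).choose_spec

/-- The specialization `y_{m+1} = y_{m+2} = ⋯ = 0`. -/
def killY (k m : ℕ) : DoubleRing k →ₐ[ℤ] MvPolynomial (Fin k ⊕ Fin m) ℤ :=
  MvPolynomial.aeval (Sum.elim
    (fun i : Fin k => MvPolynomial.X (Sum.inl i))
    (fun b : ℕ => if h : b < m then MvPolynomial.X (Sum.inr ⟨b, h⟩) else 0))

/-! ### Super-Schur functions -/

/-- The factor `x_{T(s)} + y_{T(s) + C(s)}` of the box `s = (i, j)`, of content `C(s) = j - i`,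
when the (positive) entry in this box is `t + 1`.  Every entry of a semistandard tableau satisfies
`i ≤ t` (see `row_le_entry`), so that the subtraction is not truncated. -/
def boxFactor (s : ℕ × ℕ) (t : ℕ) : MvPolynomial (ℕ ⊕ ℕ) ℤ :=
  MvPolynomial.X (Sum.inl t) + MvPolynomial.X (Sum.inr (t + s.2 - s.1))

theorem row_le_entry {lam : YoungDiagram} (T : SemistandardYoungTableau lam) {i j : ℕ}
    (h : (i, j) ∈ lam) : i ≤ T i j := by
  induction i with
  | zero => exact Nat.zero_le _
  | succ i ih =>
    have h1 := ih (lam.up_left_mem (Nat.le_succ i) le_rfl h)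
    have h2 : T i j < T (i + 1) j := T.col_strict (Nat.lt_succ_self i) h
    omega

/-- The product `∏_{s ∈ λ} (x_{T(s)} + y_{T(s) + C(s)})`.  A `SemistandardYoungTableau` has entries
in `{0, 1, 2, …}`; the tableau with positive entries that it stands for has all entries increased
by `1`. -/
def tableauWeight {lam : YoungDiagram} (T : SemistandardYoungTableau lam) :
    MvPolynomial (ℕ ⊕ ℕ) ℤ :=
  ∏ s ∈ lam.cells, boxFactor s (T s.1 s.2)

/-- Every monomial occurs in only finitely many of the products, so that the sum over all tableaux
is a well-defined formal power series. -/
theorem finite_tableaux_with_monomial (lam : YoungDiagram) (d : (ℕ ⊕ ℕ) →₀ ℕ) :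
    {T : SemistandardYoungTableau lam | (tableauWeight T).coeff d ≠ 0}.Finite := by
  classical
  obtain ⟨N, hN⟩ : ∃ N : ℕ, ∀ v ∈ d.support, Sum.elim id id v < N := by
    refine ⟨d.support.sup (fun v => Sum.elim id id v) + 1, fun v hv => ?_⟩
    exact Nat.lt_succ_of_le (Finset.le_sup (f := fun v => Sum.elim id id v) hv)
  obtain ⟨M, hM⟩ : ∃ M : ℕ, ∀ s ∈ lam.cells, s.1 < M :=
    ⟨lam.cells.sup Prod.fst + 1, fun s hs => Nat.lt_succ_of_le (Finset.le_sup (f := Prod.fst) hs)⟩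
  have hbound : ∀ T : SemistandardYoungTableau lam, (tableauWeight T).coeff d ≠ 0 →
      ∀ s ∈ lam.cells, T s.1 s.2 < N + M := by
    intro T hT s hs
    by_contra! hlt
    apply hT
    have hsM := hM s hs
    have h1 : (Sum.inl (T s.1 s.2) : ℕ ⊕ ℕ) ∉ d.support := by
      intro hv
      have := hN _ hv
      simp only [Sum.elim_inl, id] at this
      omega
    have h2 : (Sum.inr (T s.1 s.2 + s.2 - s.1) : ℕ ⊕ ℕ) ∉ d.support := by
      intro hv
      have := hN _ hv
      simp only [Sum.elim_inr, id] at this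
      omega
    rw [tableauWeight, ← Finset.mul_prod_erase _ _ hs, boxFactor, add_mul, MvPolynomial.coeff_add,
      MvPolynomial.coeff_X_mul', MvPolynomial.coeff_X_mul', if_neg h1, if_neg h2, add_zero]
  refine Set.Finite.of_finite_image (f := fun T (s : lam.cells) => T s.1.1 s.1.2) ?_ ?_
  · refine (Set.Finite.pi' (fun _ : lam.cells => Set.finite_Iio (N + M))).subset ?_
    rintro _ ⟨T, hT, rfl⟩ s
    exact hbound T hT s.1 s.2
  · intro T _ T' _ hTT'
    ext i j
    by_cases hc : (i, j) ∈ lam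
    · exact congrFun hTT' ⟨(i, j), hc⟩
    · rw [T.zeros hc, T'.zeros hc]

/-- The super-Schur function `s_λ(x_1, x_2, …; y_1, y_2, …)`: the formal power series that is the
sum, over all semistandard tableaux `T` of shape `λ` with positive integer entries, of
`∏_{s ∈ λ} (x_{T(s)} + y_{T(s) + C(s)})`.  The sum is taken coefficient by coefficient. -/
def superSchur (lam : YoungDiagram) : MvPowerSeries (ℕ ⊕ ℕ) ℤ :=
  fun d => ∑ᶠ T : SemistandardYoungTableau lam, (tableauWeight T).coeff d

/-- The super-Schur polynomial `s_λ(x_1, …, x_k; y_1, …, y_m)`: the super-Schur function with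
`x_{k+1} = x_{k+2} = ⋯ = y_{m+1} = y_{m+2} = ⋯ = 0`.  (`MvPowerSeries.killCompl e` sets to `0` all
the variables outside the range of `e`.) -/
def superSchurFin (k m : ℕ) (lam : YoungDiagram) : MvPowerSeries (Fin k ⊕ Fin m) ℤ :=
  MvPowerSeries.killCompl (Function.Embedding.sumMap Fin.valEmbedding Fin.valEmbedding)
    (superSchur lam)

end

end SchurVariations

namespace SchurVariations

open Finset Matrix

/-! Both sides equal `tableauSum`, the finite sum over tableaux with entries less than `k`. For the
double Schur polynomial this is induction on `k` (`det_eq_prod_mul_tableauSum`): row operations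
split the last variable off the alternant (`det_factorial_powers_succ`), removing the largest
entries splits a horizontal strip off each tableau (`mul_tableauSum_succ`), and the two recursions
coincide. For the super-Schur polynomial, a box in row `i < ℓ(λ)` with entry at least `k` (both
counted from 0) has its `x` set to `0`, and its `y` has index at least `k - i ≥ m`, so that is `0`
too. Hence only tableaux with entries less than `k` survive (`superSchurFin_eq_tableauSum`). -/

/-! ### Splitting the last variable off an alternant. -/

/-- Telescoping: trading the factors `x + y t` for `z + y t` one at a time, each trade contributes a
multiple of `x - z`. -/
theorem prod_range_sub_prod_Ico_mul_prod_range {R : Type*} [CommRing R] (y : ℕ → R) (x z : R)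
    {a b : ℕ} (hab : a ≤ b) :
    (∏ t ∈ range b, (x + y t)) - (∏ t ∈ Ico a b, (z + y t)) * ∏ t ∈ range a, (x + y t) =
      (x - z) * ∑ j ∈ Ico a b, (∏ t ∈ Ico (j + 1) b, (z + y t)) * ∏ t ∈ range j, (x + y t) := by
  induction b, hab using Nat.le_induction with
  | base => simp
  | succ b hab ih =>
    have h1 : ∑ j ∈ Ico a b, (∏ t ∈ Ico (j + 1) (b + 1), (z + y t)) * ∏ t ∈ range j, (x + y t) =
        (z + y b) *
          ∑ j ∈ Ico a b, (∏ t ∈ Ico (j + 1) b, (z + y t)) * ∏ t ∈ range j, (x + y t) := by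
      rw [mul_sum]
      refine sum_congr rfl fun j hj => ?_
      rw [prod_Ico_succ_top (by have := mem_Ico.mp hj; omega)]
      ring
    rw [prod_range_succ, prod_Ico_succ_top hab, sum_Ico_succ_top hab, h1, Ico_self, prod_empty]
    linear_combination (z + y b) * ih

/-- Branching rule for the alternants of the factorial powers `∏ b < i, (x + y_b)`: the last
variable is split off. -/
theorem det_factorial_powers_succ {R : Type*} [CommRing R] (x y : ℕ → R) (k : ℕ)
    (I : Fin (k + 1) → ℕ) (hI : ∀ r : Fin k, I r.castSucc ≤ I r.succ) :
    (Matrix.of fun r j : Fin (k + 1) => ∏ b ∈ range (I r), (x j + y b)).det =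
      (∏ j : Fin k, (x k - x j)) * ((∏ b ∈ range (I 0), (x k + y b)) *
        ∑ J ∈ Fintype.piFinset fun r : Fin k => Ico (I r.castSucc) (I r.succ),
          (∏ r, ∏ b ∈ Ico (J r + 1) (I r.succ), (x k + y b)) *
            (Matrix.of fun r j : Fin k => ∏ b ∈ range (J r), (x j + y b)).det) := by
  -- In the last column, row `r + 1` is exactly `c r` times row `r`, so subtracting clears that
  -- column below the top entry.
  let c : Fin k → R := fun r => ∏ t ∈ Ico (I r.castSucc) (I r.succ), (x k + y t)
  let A : Matrix (Fin (k + 1)) (Fin (k + 1)) R :=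
    Matrix.of fun r j => ∏ b ∈ range (I r), (x j + y b)
  let B : Matrix (Fin (k + 1)) (Fin (k + 1)) R :=
    Matrix.of fun r j => Fin.cases (A 0 j) (fun r' : Fin k => A r'.succ j - c r' * A r'.castSucc j) r
  have hAB : A.det = B.det := by
    refine det_eq_of_forall_row_eq_smul_add_pred c (fun j => by simp [B]) (fun i j => ?_)
    simp [B]
  have hlast : ∀ r : Fin k, B r.succ (Fin.last k) = 0 := by
    intro r
    simp only [B, A, c, Matrix.of_apply, Fin.cases_succ, Fin.val_last]
    rw [prod_range_sub_prod_Ico_mul_prod_range y (x k) (x k) (hI r)]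
    simp
  -- What remains of the minor once `x j - x k` is taken out of each column. Each row is a sum, so
  -- multilinearity yields one alternant for every choice `J` of summands.
  let D : Matrix (Fin k) (Fin k) R := Matrix.of fun r j =>
    ∑ i ∈ Ico (I r.castSucc) (I r.succ), (∏ t ∈ Ico (i + 1) (I r.succ), (x k + y t)) *
      ∏ t ∈ range i, (x j + y t)
  have hsub : B.submatrix (Fin.succAbove 0) (Fin.last k).succAbove =
      Matrix.of fun r j : Fin k => (x j - x k) * D r j := by
    ext r j
    simp only [B, A, c, D, Matrix.submatrix_apply, Matrix.of_apply, Fin.succAbove_zero,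
      Fin.succAbove_last, Fin.cases_succ, Fin.val_castSucc]
    exact prod_range_sub_prod_Ico_mul_prod_range y (x j) (x k) (hI r)
  have hD : D.det = ∑ J ∈ Fintype.piFinset fun r : Fin k => Ico (I r.castSucc) (I r.succ),
      (∏ r, ∏ b ∈ Ico (J r + 1) (I r.succ), (x k + y b)) *
        (Matrix.of fun r j : Fin k => ∏ b ∈ range (J r), (x j + y b)).det := by
    have h1 := (detRowAlternating (R := R) (n := Fin k)).toMultilinearMap.map_sum_finset
      (fun (r : Fin k) (i : ℕ) (j : Fin k) => (∏ t ∈ Ico (i + 1) (I r.succ), (x k + y t)) *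
      ∏ t ∈ range i, (x j + y t)) (fun r : Fin k => Ico (I r.castSucc) (I r.succ))
    have h2 : D.det = (detRowAlternating (R := R) (n := Fin k)).toMultilinearMap
        (fun r => ∑ i ∈ Ico (I r.castSucc) (I r.succ), fun j =>
          (∏ t ∈ Ico (i + 1) (I r.succ), (x k + y t)) * ∏ t ∈ range i, (x j + y t)) := by
      change D.det = Matrix.det _
      congr 1
      ext r j
      simp [D]
    rw [h2, h1]
    refine sum_congr rfl fun J _ => ?_
    exact det_mul_column (fun r => ∏ b ∈ Ico (J r + 1) (I r.succ), (x k + y b))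
      (Matrix.of fun r j : Fin k => ∏ b ∈ range (J r), (x j + y b))
  change A.det = _
  rw [hAB, det_succ_column B (Fin.last k), Fin.sum_univ_succ]
  simp only [hlast, mul_zero, zero_mul, sum_const_zero, add_zero]
  rw [hsub, det_mul_row, hD]
  -- This sign cancels the cofactor sign of the entry in row `0`, column `k`.
  have hsign : ∏ j : Fin k, (x j - x k) = (-1) ^ k * ∏ j : Fin k, (x k - x j) := by
    rw [← Fin.prod_const, ← prod_mul_distrib]
    exact prod_congr rfl fun j _ => by ring
  have hpow : ((-1 : R) ^ k) * (-1) ^ k = 1 := by rw [← mul_pow]; simp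
  have hB : B 0 (Fin.last k) = ∏ b ∈ range (I 0), (x k + y b) := by simp [B, A]
  rw [hsign, hB]
  simp only [Fin.val_zero, Fin.val_last, zero_add]
  linear_combination (∏ j : Fin k, (x k - x j)) * ((∏ b ∈ range (I 0), (x k + y b)) *
        ∑ J ∈ Fintype.piFinset fun r : Fin k => Ico (I r.castSucc) (I r.succ),
          (∏ r, ∏ b ∈ Ico (J r + 1) (I r.succ), (x k + y b)) *
            (Matrix.of fun r j : Fin k => ∏ b ∈ range (J r), (x j + y b)).det) * hpow


/-! ### Partitions, row indices and horizontal strips. -/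

theorem lt_length_of_mem {lam : YoungDiagram} {i j : ℕ} (h : (i, j) ∈ lam) : i < length lam :=
  YoungDiagram.mem_iff_lt_colLen.mp (lam.up_left_mem le_rfl (Nat.zero_le j) h)

theorem length_le_iff {lam : YoungDiagram} {k : ℕ} : length lam ≤ k ↔ lam.rowLen k = 0 := by
  rw [← not_lt, length, ← YoungDiagram.mem_iff_lt_colLen, YoungDiagram.mem_iff_lt_rowLen]
  omega

theorem rowLen_eq_zero {lam : YoungDiagram} {i : ℕ} (h : length lam ≤ i) : lam.rowLen i = 0 :=
  length_le_iff.mp h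

theorem eq_of_rowLen_eq {lam mu : YoungDiagram} (h : ∀ i, lam.rowLen i = mu.rowLen i) :
    lam = mu := by
  ext ⟨i, j⟩
  rw [YoungDiagram.mem_cells, YoungDiagram.mem_cells, YoungDiagram.mem_iff_lt_rowLen,
    YoungDiagram.mem_iff_lt_rowLen, h]

theorem exists_rowLen_eq {a : ℕ → ℕ} (ha : Antitone a) {k : ℕ} (hk : a k = 0) :
    ∃ mu : YoungDiagram, ∀ i, mu.rowLen i = a i := by
  refine ⟨⟨(range k ×ˢ range (a 0)).filter fun c => c.2 < a c.1, ?_⟩, fun i => ?_⟩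
  · rintro ⟨i, j⟩ ⟨i', j'⟩ hle hmem
    obtain ⟨hi, hj⟩ := Prod.mk_le_mk.mp hle
    have := ha hi
    simp only [coe_filter, mem_product, mem_range, Set.mem_ofPred_eq] at hmem ⊢
    omega
  · refine eq_of_forall_lt_iff fun j => ?_
    rw [← YoungDiagram.mem_iff_lt_rowLen, ← YoungDiagram.mem_cells]
    simp only [mem_filter, mem_product, mem_range]
    refine ⟨fun h => h.2, fun h => ⟨⟨?_, h.trans_le (ha (Nat.zero_le i))⟩, h⟩⟩
    by_contra! hki
    have := ha hki
    omega

/-- A partition with at most `k` parts is determined by its row indices. -/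
theorem eq_of_rowIndex_eq {k : ℕ} {lam mu : YoungDiagram} (hlam : length lam ≤ k)
    (hmu : length mu ≤ k) (h : rowIndex k lam = rowIndex k mu) : lam = mu := by
  refine eq_of_rowLen_eq fun i => ?_
  rcases lt_or_ge i k with hi | hi
  · have := congrFun h (Fin.rev ⟨i, hi⟩)
    simpa [rowIndex] using this
  · rw [rowLen_eq_zero (hlam.trans hi), rowLen_eq_zero (hmu.trans hi)]

/-- `lam / mu` is a horizontal strip. -/
def Interlaces (mu lam : YoungDiagram) : Prop :=
  ∀ i, lam.rowLen (i + 1) ≤ mu.rowLen i ∧ mu.rowLen i ≤ lam.rowLen i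

theorem Interlaces.le {mu lam : YoungDiagram} (h : Interlaces mu lam) {i j : ℕ}
    (hij : (i, j) ∈ mu) : (i, j) ∈ lam := by
  rw [YoungDiagram.mem_iff_lt_rowLen] at hij ⊢
  exact hij.trans_le (h i).2

/-- Passing from `r` to `r.succ` shifts the row index by one, which turns the weak upper bound on
parts into the strict bound of `Ico`. -/
theorem Interlaces.mem_piFinset {mu lam : YoungDiagram} (h : Interlaces mu lam) (k : ℕ) :
    rowIndex k mu ∈ Fintype.piFinset fun r : Fin k =>
      Ico (rowIndex (k + 1) lam r.castSucc) (rowIndex (k + 1) lam r.succ) := by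
  rw [Fintype.mem_piFinset]
  intro r
  have h1 := h (Fin.rev r)
  have h2 : ((Fin.rev r.castSucc : Fin (k + 1)) : ℕ) = (Fin.rev r : ℕ) + 1 := by
    simp only [Fin.val_rev, Fin.val_castSucc]; omega
  have h3 : ((Fin.rev r.succ : Fin (k + 1)) : ℕ) = (Fin.rev r : ℕ) := by
    simp only [Fin.val_rev, Fin.val_succ]; omega
  rw [mem_Ico, rowIndex, rowIndex, rowIndex, h2, h3, Fin.val_castSucc, Fin.val_succ]
  omega

theorem exists_interlaces_of_mem_piFinset {lam : YoungDiagram} {k : ℕ} (hlam : length lam ≤ k + 1)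
    {J : Fin k → ℕ} (hJ : J ∈ Fintype.piFinset fun r : Fin k =>
      Ico (rowIndex (k + 1) lam r.castSucc) (rowIndex (k + 1) lam r.succ)) :
    ∃ mu, Interlaces mu lam ∧ length mu ≤ k ∧ rowIndex k mu = J := by
  -- This inverts `rowIndex`. The subtraction is exact because the lower bound on `J r` is at least
  -- `r`.
  let a : ℕ → ℕ := fun i => if h : i < k then J (Fin.rev ⟨i, h⟩) - Fin.rev (⟨i, h⟩ : Fin k) else 0
  have hbd : ∀ i, lam.rowLen (i + 1) ≤ a i ∧ a i ≤ lam.rowLen i := by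
    intro i
    rcases lt_or_ge i k with hi | hi
    · have h1 := (Fintype.mem_piFinset.mp hJ) (Fin.rev ⟨i, hi⟩)
      have h2 : ((Fin.rev (Fin.rev (⟨i, hi⟩ : Fin k)).castSucc : Fin (k + 1)) : ℕ) = i + 1 := by
        simp only [Fin.val_rev, Fin.val_castSucc]; omega
      have h3 : ((Fin.rev (Fin.rev (⟨i, hi⟩ : Fin k)).succ : Fin (k + 1)) : ℕ) = i := by
        simp only [Fin.val_rev, Fin.val_succ]; omega
      rw [mem_Ico, rowIndex, rowIndex, h2, h3, Fin.val_castSucc, Fin.val_succ] at h1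
      simp only [a, dif_pos hi]
      omega
    · simp only [a, dif_neg (not_lt.mpr hi)]
      rw [rowLen_eq_zero (hlam.trans (by omega))]
      omega
  have ha : Antitone a := antitone_nat_of_succ_le fun i => (hbd (i + 1)).2.trans (hbd i).1
  have hak : a k = 0 := by simp [a]
  obtain ⟨mu, hmu⟩ := exists_rowLen_eq ha hak
  refine ⟨mu, fun i => by rw [hmu]; exact hbd i, length_le_iff.mpr (by rw [hmu, hak]), ?_⟩
  ext r
  have h1 := (mem_Ico.mp ((Fintype.mem_piFinset.mp hJ) r)).1
  rw [rowIndex, Fin.val_castSucc] at h1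
  have h4 : (Fin.rev (⟨Fin.rev r, (Fin.rev r).2⟩ : Fin k)) = r := Fin.rev_rev r
  rw [rowIndex, hmu]
  simp only [a, dif_pos (Fin.rev r).2, h4]
  omega

/-- The product over the boxes of a skew shape, row by row. -/
theorem prod_sdiff_cells {M : Type*} [CommMonoid M] {mu lam : YoungDiagram} {k : ℕ}
    (hlam : length lam ≤ k + 1) (hmu : length mu ≤ k)
    (f : ℕ → M) :
    ∏ s ∈ lam.cells \ mu.cells, f (k + s.2 - s.1) =
      (∏ b ∈ range (rowIndex (k + 1) lam 0), f b) *
        ∏ r : Fin k, ∏ b ∈ Ico (rowIndex k mu r + 1) (rowIndex (k + 1) lam r.succ), f b := by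
  have h1 : ∏ s ∈ lam.cells \ mu.cells, f (k + s.2 - s.1) =
      ∏ i ∈ range (k + 1), ∏ j ∈ Ico (mu.rowLen i) (lam.rowLen i), f (k + j - i) := by
    rw [prod_sigma']
    refine prod_bij' (fun s _ => ⟨s.1, s.2⟩) (fun s _ => (s.1, s.2)) ?_ ?_ ?_ ?_ ?_
    · rintro ⟨i, j⟩ hs
      rw [mem_sdiff, YoungDiagram.mem_cells, YoungDiagram.mem_cells] at hs
      have hi := lt_length_of_mem hs.1
      rw [YoungDiagram.mem_iff_lt_rowLen, YoungDiagram.mem_iff_lt_rowLen] at hs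
      simp only [mem_sigma, mem_range, mem_Ico]
      omega
    · rintro ⟨i, j⟩ hs
      simp only [mem_sigma, mem_range, mem_Ico] at hs
      dsimp only
      rw [mem_sdiff, YoungDiagram.mem_cells, YoungDiagram.mem_cells,
        YoungDiagram.mem_iff_lt_rowLen, YoungDiagram.mem_iff_lt_rowLen]
      omega
    · intros; rfl
    · intros; rfl
    · intros; rfl
  rw [h1, prod_range_succ, mul_comm]
  congr 1
  -- Row `k` of `mu` is empty, so this row of `lam` gives the separate initial factor.
  · rw [rowLen_eq_zero hmu, ← range_eq_Ico]
    simp [rowIndex]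
  -- Row `Fin.rev r` is `k - (r + 1)`, so its argument `k + j - i` is `j + (r + 1)`.
  · rw [prod_range, ← Equiv.prod_comp Fin.revPerm]
    refine prod_congr rfl fun r _ => ?_
    have h3 : ((Fin.rev r.succ : Fin (k + 1)) : ℕ) = (Fin.rev r : ℕ) := by
      simp only [Fin.val_rev, Fin.val_succ]; omega
    have h4 : (Fin.rev r : ℕ) + (r + 1) = k := by simp only [Fin.val_rev]; omega
    rw [rowIndex, rowIndex, h3, Fin.val_succ, Fin.revPerm_apply, add_assoc,
      ← prod_Ico_add' f _ _ ((r : ℕ) + 1)]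
    exact prod_congr rfl fun j _ => by congr 1; omega


/-! ### Bounded tableaux and the removal of the largest entry. -/

theorem finite_bounded_tableaux (k : ℕ) (lam : YoungDiagram) :
    {T : SemistandardYoungTableau lam | ∀ s ∈ lam.cells, T s.1 s.2 < k}.Finite := by
  refine Set.Finite.of_finite_image (f := fun T (s : lam.cells) => T s.1.1 s.1.2) ?_ ?_
  · refine (Set.Finite.pi' (fun _ : lam.cells => Set.finite_Iio k)).subset ?_
    rintro _ ⟨T, hT, rfl⟩ s
    exact hT s.1 s.2
  · intro T _ T' _ hTT'
    ext i j
    by_cases hc : (i, j) ∈ lam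
    · exact congrFun hTT' ⟨(i, j), hc⟩
    · rw [T.zeros hc, T'.zeros hc]

/-- The semistandard tableaux of shape `lam` with entries less than `k`. -/
noncomputable def boundedTableaux (k : ℕ) (lam : YoungDiagram) :
    Finset (SemistandardYoungTableau lam) :=
  (finite_bounded_tableaux k lam).toFinset

theorem mem_boundedTableaux {k : ℕ} {lam : YoungDiagram} {T : SemistandardYoungTableau lam} :
    T ∈ boundedTableaux k lam ↔ ∀ i j, (i, j) ∈ lam → T i j < k := by
  rw [boundedTableaux, Set.Finite.mem_toFinset]
  exact ⟨fun h i j hij => h (i, j) hij, fun h s hs => h s.1 s.2 hs⟩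

/-- The shape formed by the entries less than `k` of a tableau. -/
def subshape {lam : YoungDiagram} (k : ℕ) (T : SemistandardYoungTableau lam) : YoungDiagram where
  cells := lam.cells.filter fun s => T s.1 s.2 < k
  isLowerSet := by
    rintro ⟨i, j⟩ ⟨i', j'⟩ hle hmem
    obtain ⟨hi, hj⟩ := Prod.mk_le_mk.mp hle
    simp only [coe_filter, Set.mem_ofPred_eq, YoungDiagram.mem_cells] at hmem ⊢
    exact ⟨lam.up_left_mem hi hj hmem.1, ((T.row_weak_of_le hj
      (lam.up_left_mem hi le_rfl hmem.1)).trans (T.col_weak hi hmem.1)).trans_lt hmem.2⟩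

theorem mem_subshape {lam : YoungDiagram} {k : ℕ} {T : SemistandardYoungTableau lam} {i j : ℕ} :
    (i, j) ∈ subshape k T ↔ (i, j) ∈ lam ∧ T i j < k := by
  rw [← YoungDiagram.mem_cells]
  simp [subshape]

theorem length_subshape_le {lam : YoungDiagram} (k : ℕ) (T : SemistandardYoungTableau lam) :
    length (subshape k T) ≤ k := by
  by_contra! h
  have h1 := mem_subshape.mp (YoungDiagram.mem_iff_lt_colLen.mpr h)
  have := row_le_entry T h1.1
  omega

theorem interlaces_subshape {lam : YoungDiagram} {k : ℕ} {T : SemistandardYoungTableau lam}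
    (hT : T ∈ boundedTableaux (k + 1) lam) : Interlaces (subshape k T) lam := by
  rw [mem_boundedTableaux] at hT
  intro i
  constructor <;> refine le_of_forall_lt fun j hj => ?_ <;>
    rw [← YoungDiagram.mem_iff_lt_rowLen] at hj ⊢
  -- A box with another box below it cannot carry the maximal entry `k`.
  · have h1 : T i j < T (i + 1) j := T.col_strict (Nat.lt_succ_self i) hj
    have h2 := hT _ _ hj
    exact mem_subshape.mpr ⟨lam.up_left_mem (Nat.le_succ i) le_rfl hj, by omega⟩
  · exact (mem_subshape.mp hj).1

/-- The restriction of a tableau to its entries less than `k`. -/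
def restrictTableau {lam mu : YoungDiagram} (T : SemistandardYoungTableau lam)
    (h : ∀ {i j}, (i, j) ∈ mu → (i, j) ∈ lam) : SemistandardYoungTableau mu where
  entry i j := if (i, j) ∈ mu then T i j else 0
  row_weak' {i j1 j2} hj hc := by
    rw [if_pos hc, if_pos (mu.up_left_mem le_rfl hj.le hc)]
    exact T.row_weak hj (h hc)
  col_strict' {i1 i2 j} hi hc := by
    rw [if_pos hc, if_pos (mu.up_left_mem hi.le le_rfl hc)]
    exact T.col_strict hi (h hc)
  zeros' hc := if_neg hc

/-- The extension of a tableau by entries `k` along a horizontal strip. -/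
def extendTableau {lam mu : YoungDiagram} {k : ℕ} (h : Interlaces mu lam)
    (S : SemistandardYoungTableau mu) (hS : S ∈ boundedTableaux k mu) :
    SemistandardYoungTableau lam where
  entry i j := if (i, j) ∈ mu then S i j else if (i, j) ∈ lam then k else 0
  row_weak' {i j1 j2} hj hc := by
    rw [mem_boundedTableaux] at hS
    rw [if_pos hc, if_pos (lam.up_left_mem le_rfl hj.le hc)]
    by_cases h2 : (i, j2) ∈ mu
    · rw [if_pos h2, if_pos (mu.up_left_mem le_rfl hj.le h2)]
      exact S.row_weak hj h2
    · rw [if_neg h2]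
      split_ifs with h1
      · exact (hS _ _ h1).le
      · exact le_rfl
  col_strict' {i1 i2 j} hi hc := by
    rw [mem_boundedTableaux] at hS
    -- In a horizontal strip, a box above a box of `lam` lies in `mu`; hence no column receives `k`
    -- twice.
    have h1 : (i1, j) ∈ mu := by
      have hc' := lam.up_left_mem (Nat.succ_le_of_lt hi) le_rfl hc
      rw [YoungDiagram.mem_iff_lt_rowLen] at hc' ⊢
      exact hc'.trans_le (h i1).1
    rw [if_pos h1, if_pos hc]
    split_ifs with h2
    · exact S.col_strict hi h2
    · exact hS _ _ h1
  zeros' hc := by rw [if_neg (fun hm => hc (h.le hm)), if_neg hc]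

theorem restrictTableau_apply {lam mu : YoungDiagram} (T : SemistandardYoungTableau lam)
    (h : ∀ {i j}, (i, j) ∈ mu → (i, j) ∈ lam) (i j : ℕ) :
    restrictTableau T h i j = if (i, j) ∈ mu then T i j else 0 := rfl

theorem extendTableau_apply {lam mu : YoungDiagram} {k : ℕ} (h : Interlaces mu lam)
    (S : SemistandardYoungTableau mu) (hS : S ∈ boundedTableaux k mu) (i j : ℕ) :
    extendTableau h S hS i j = if (i, j) ∈ mu then S i j else if (i, j) ∈ lam then k else 0 := rfl

theorem extendTableau_mem {lam mu : YoungDiagram} {k : ℕ} (h : Interlaces mu lam)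
    (S : SemistandardYoungTableau mu) (hS : S ∈ boundedTableaux k mu) :
    extendTableau h S hS ∈ boundedTableaux (k + 1) lam := by
  rw [mem_boundedTableaux]
  intro i j hij
  rw [extendTableau_apply, if_pos hij]
  split_ifs with h1
  · have := mem_boundedTableaux.mp hS _ _ h1
    omega
  · omega

theorem subshape_extendTableau {lam mu : YoungDiagram} {k : ℕ} (h : Interlaces mu lam)
    (S : SemistandardYoungTableau mu) (hS : S ∈ boundedTableaux k mu) :
    subshape k (extendTableau h S hS) = mu := by
  ext ⟨i, j⟩
  rw [YoungDiagram.mem_cells, YoungDiagram.mem_cells, mem_subshape, extendTableau_apply]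
  by_cases h1 : (i, j) ∈ mu
  · rw [if_pos h1]
    exact ⟨fun _ => h1, fun _ => ⟨h.le h1, mem_boundedTableaux.mp hS _ _ h1⟩⟩
  · rw [if_neg h1]
    refine ⟨fun h2 => ?_, fun h2 => absurd h2 h1⟩
    rw [if_pos h2.1] at h2
    omega

/-! ### Tableau sums and their branching rule. -/

section Weight

variable {R : Type*} [CommRing R] (x y : ℕ → R)

/-- The product `∏ (x_{T(s)} + y_{T(s) + C(s)})` over the boxes of a tableau. -/
def tableauProd {lam : YoungDiagram} (T : SemistandardYoungTableau lam) : R :=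
  ∏ s ∈ lam.cells, (x (T s.1 s.2) + y (T s.1 s.2 + s.2 - s.1))

/-- The sum of `tableauProd x y` over the tableaux with entries less than `k`. -/
noncomputable def tableauSum (k : ℕ) (lam : YoungDiagram) : R :=
  ∑ T ∈ boundedTableaux k lam, tableauProd x y T

/-- The contribution of the tableaux whose entries less than `k` form a given shape. -/
theorem sum_tableauProd_subshape_eq [DecidableEq YoungDiagram] {lam mu : YoungDiagram} {k : ℕ}
    (h : Interlaces mu lam) :
    ∑ T ∈ boundedTableaux (k + 1) lam with subshape k T = mu, tableauProd x y T =
      (∏ s ∈ lam.cells \ mu.cells, (x k + y (k + s.2 - s.1))) * tableauSum x y k mu := by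
  rw [tableauSum, mul_sum]
  have hsub : mu.cells ⊆ lam.cells := fun s hs => h.le hs
  have hfull : ∀ T ∈ (boundedTableaux (k + 1) lam).filter (fun T => subshape k T = mu),
      ∀ i j, (i, j) ∉ mu → (i, j) ∈ lam → T i j = k := by
    intro T hT i j h1 h2
    obtain ⟨hT1, hT2⟩ := mem_filter.mp hT
    have h3 := mem_boundedTableaux.mp hT1 _ _ h2
    rw [← hT2, mem_subshape, not_and] at h1
    have := h1 h2
    omega
  have hres : ∀ T ∈ (boundedTableaux (k + 1) lam).filter (fun T => subshape k T = mu),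
      restrictTableau T h.le ∈ boundedTableaux k mu := by
    intro T hT
    rw [mem_boundedTableaux]
    intro i j hij
    rw [restrictTableau_apply, if_pos hij]
    rw [← (mem_filter.mp hT).2] at hij
    exact (mem_subshape.mp hij).2
  refine sum_bij' (fun T _ => restrictTableau T h.le) (fun S hS => extendTableau h S hS) hres
    (fun S hS => mem_filter.mpr ⟨extendTableau_mem h S hS, subshape_extendTableau h S hS⟩)
    ?_ ?_ ?_
  · intro T hT
    ext i j
    rw [extendTableau_apply, restrictTableau_apply]
    split_ifs with h1 h2
    · rfl
    · exact (hfull T hT i j h1 h2).symm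
    · exact (T.zeros h2).symm
  · intro S hS
    ext i j
    rw [restrictTableau_apply, extendTableau_apply]
    split_ifs with h1
    · rfl
    · exact (S.zeros h1).symm
  · intro T hT
    rw [tableauProd, tableauProd, ← prod_sdiff hsub]
    congr 1
    · refine prod_congr rfl fun s hs => ?_
      obtain ⟨h1, h2⟩ := mem_sdiff.mp hs
      rw [hfull T hT s.1 s.2 h2 h1]
    · refine prod_congr rfl fun s hs => ?_
      rw [restrictTableau_apply, if_pos (YoungDiagram.mem_cells _ |>.mp hs)]

/-- Branching rule for tableau sums: the boxes with the largest entry are split off. -/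
theorem mul_tableauSum_succ (k : ℕ) {lam : YoungDiagram} (hlam : length lam ≤ k + 1) (v : R)
    (F : (Fin k → ℕ) → R)
    (hF : ∀ mu, length mu ≤ k → F (rowIndex k mu) = v * tableauSum x y k mu) :
    v * tableauSum x y (k + 1) lam = (∏ b ∈ range (rowIndex (k + 1) lam 0), (x k + y b)) *
      ∑ J ∈ Fintype.piFinset fun r : Fin k =>
          Ico (rowIndex (k + 1) lam r.castSucc) (rowIndex (k + 1) lam r.succ),
        (∏ r, ∏ b ∈ Ico (J r + 1) (rowIndex (k + 1) lam r.succ), (x k + y b)) * F J := by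
  classical
  -- Tableaux are grouped by the row indices of their subshape, to match the determinant expansion.
  -- Every `J` in the range is such an index, so `hF` suffices.
  rw [tableauSum, mul_sum, ← sum_fiberwise_of_maps_to (g := fun T => rowIndex k (subshape k T))
    fun T hT => (interlaces_subshape hT).mem_piFinset k, mul_sum]
  refine sum_congr rfl fun J hJ => ?_
  obtain ⟨mu, hint, hmu, rfl⟩ := exists_interlaces_of_mem_piFinset hlam hJ
  have hfil : (boundedTableaux (k + 1) lam).filter
      (fun T => rowIndex k (subshape k T) = rowIndex k mu) =
        (boundedTableaux (k + 1) lam).filter (fun T => subshape k T = mu) :=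
    filter_congr fun T _ =>
      ⟨eq_of_rowIndex_eq (length_subshape_le k T) hmu, fun hT => by rw [hT]⟩
  rw [hfil, ← mul_sum, sum_tableauProd_subshape_eq x y hint,
    prod_sdiff_cells hlam hmu (fun b => x k + y b), hF mu hmu]
  ring

/-- The ratio of alternants is the sum over tableaux. -/
theorem det_eq_prod_mul_tableauSum (k : ℕ) {lam : YoungDiagram} (hlam : length lam ≤ k) :
    (Matrix.of fun r j : Fin k => ∏ b ∈ range (rowIndex k lam r), (x j + y b)).det =
      (∏ j : Fin k, ∏ a ∈ Iio j, (x j - x a)) * tableauSum x y k lam := by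
  induction k generalizing lam with
  | zero =>
    have hbot : lam.cells = ∅ := by
      refine eq_empty_of_forall_notMem fun s hs => ?_
      have := lt_length_of_mem (i := s.1) (j := s.2) hs
      omega
    have hsub : boundedTableaux 0 lam = {default} := by
      ext T
      have : T = default := by
        ext i j
        have hij : (i, j) ∉ lam := by rw [← YoungDiagram.mem_cells, hbot]; simp
        rw [T.zeros hij, SemistandardYoungTableau.zeros _ hij]
      rw [mem_boundedTableaux, this]
      refine ⟨fun _ => mem_singleton_self _, fun _ i j hij => ?_⟩
      rw [← YoungDiagram.mem_cells, hbot] at hij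
      simp at hij
    simp [tableauSum, hsub, tableauProd, hbot]
  | succ k ih =>
    have hv : ∏ j : Fin (k + 1), ∏ a ∈ Iio j, (x j - x a) =
        (∏ j : Fin k, (x k - x j)) * ∏ j : Fin k, ∏ a ∈ Iio j, (x j - x a) := by
      rw [Fin.prod_univ_castSucc, mul_comm, Fin.Iio_last_eq_map, prod_map]
      congr 1
      refine prod_congr rfl fun j _ => ?_
      rw [Fin.Iio_castSucc, prod_map]
      rfl
    have hmono : ∀ r : Fin k,
        rowIndex (k + 1) lam r.castSucc ≤ rowIndex (k + 1) lam r.succ := by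
      intro r
      have h1 : ((Fin.rev r.succ : Fin (k + 1)) : ℕ) ≤ Fin.rev r.castSucc := by
        simp only [Fin.val_rev, Fin.val_succ, Fin.val_castSucc]; omega
      have h2 := lam.rowLen_anti _ _ h1
      rw [rowIndex, rowIndex, Fin.val_castSucc, Fin.val_succ]
      omega
    rw [det_factorial_powers_succ x y k _ hmono, hv, mul_assoc,
      mul_tableauSum_succ x y k hlam _
        (fun J => (Matrix.of fun r j : Fin k => ∏ b ∈ range (J r), (x j + y b)).det)
        fun mu hmu => ih hmu]

theorem map_tableauSum {S : Type*} [CommRing S] (f : R →+* S) (k : ℕ) (lam : YoungDiagram) :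
    f (tableauSum x y k lam) = tableauSum (fun i => f (x i)) (fun i => f (y i)) k lam := by
  simp [tableauSum, tableauProd]

end Weight


/-! ### Comparison of the two specializations. -/

/-- The double Schur polynomial is the sum over tableaux with entries less than `k`; `x` may take
any values outside the given variables. -/
theorem doubleSchur_eq_tableauSum {k : ℕ} {lam : YoungDiagram} (hlam : length lam ≤ k)
    (x : ℕ → DoubleRing k) (hx : ∀ j : Fin k, x j = MvPolynomial.X (Sum.inl j)) :
    doubleSchur k lam =
      tableauSum x (fun b => (MvPolynomial.X (Sum.inr b) : DoubleRing k)) k lam := by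
  let φ := algebraMap (DoubleRing k) (FractionRing (DoubleRing k))
  have hφ : Function.Injective φ := IsFractionRing.injective _ _
  apply hφ
  have hdet := det_eq_prod_mul_tableauSum x
    (fun b => (MvPolynomial.X (Sum.inr b) : DoubleRing k)) k hlam
  have hden : ∏ j : Fin k, ∏ a ∈ Iio j, (x j - x a) = ∏ j : Fin k, zDenominator k j := by
    simp [hx, zDenominator]
  have hnum : (Matrix.of fun r j : Fin k => ∏ b ∈ range (rowIndex k lam r),
      (x j + MvPolynomial.X (Sum.inr b))) =
        Matrix.of fun r j : Fin k => zNumerator k (rowIndex k lam r) j := by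
    ext1 r j
    simp [hx, zNumerator]
  rw [hden, hnum] at hdet
  have hne : φ (∏ j : Fin k, zDenominator k j) ≠ 0 :=
    (map_ne_zero_iff φ hφ).mpr (prod_ne_zero_iff.mpr fun j _ => zDenominator_ne_zero k j)
  have hminor : flagMinor k lam = (Matrix.of fun r j : Fin k => (φ (zDenominator k j))⁻¹ *
      φ.mapMatrix (Matrix.of fun r j : Fin k => zNumerator k (rowIndex k lam r) j) r j).det := by
    unfold flagMinor
    congr 1
    ext r j
    simp [zMatrix, div_eq_inv_mul, φ]
  rw [algebraMap_doubleSchur k lam hlam, hminor, Matrix.det_mul_row, ← RingHom.map_det, hdet,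
    map_mul, prod_inv_distrib, ← map_prod, inv_mul_cancel_left₀ hne]

/-- The variable `x_{i+1}`, set to `0` for `i ≥ k`. -/
noncomputable def truncX (k m i : ℕ) : MvPolynomial (Fin k ⊕ Fin m) ℤ :=
  if h : i < k then MvPolynomial.X (Sum.inl ⟨i, h⟩) else 0

/-- The variable `y_{b+1}`, set to `0` for `b ≥ m`. -/
noncomputable def truncY (k m b : ℕ) : MvPolynomial (Fin k ⊕ Fin m) ℤ :=
  if h : b < m then MvPolynomial.X (Sum.inr ⟨b, h⟩) else 0

theorem killY_doubleSchur {k : ℕ} (m : ℕ) {lam : YoungDiagram} (hlam : length lam ≤ k) :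
    killY k m (doubleSchur k lam) = tableauSum (truncX k m) (truncY k m) k lam := by
  rw [doubleSchur_eq_tableauSum hlam
    -- Padding by `0` makes the image under `killY` equal to `truncX`.
    (fun i => if h : i < k then MvPolynomial.X (Sum.inl ⟨i, h⟩) else 0) (fun j => by simp)]
  have := map_tableauSum
    (fun i => if h : i < k then (MvPolynomial.X (Sum.inl ⟨i, h⟩) : DoubleRing k) else 0)
    (fun b => (MvPolynomial.X (Sum.inr b) : DoubleRing k)) (killY k m).toRingHom k lam
  refine this.trans ?_
  congr 1
  · ext1 i
    rw [truncX]
    split_ifs with h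
    · simp [killY]
    · simp
  · ext1 b
    simp [killY, truncY]

theorem killCompl_tableauWeight (k m : ℕ) {lam : YoungDiagram}
    (T : SemistandardYoungTableau lam) :
    MvPolynomial.killCompl
        (Function.Embedding.sumMap (Fin.valEmbedding (n := k)) (Fin.valEmbedding (n := m))).injective
        (tableauWeight T) =
      tableauProd (truncX k m) (truncY k m) T := by
  set e := Function.Embedding.sumMap (Fin.valEmbedding (n := k)) (Fin.valEmbedding (n := m)) with he
  have hx : ∀ i, MvPolynomial.killCompl (R := ℤ) e.injective (MvPolynomial.X (Sum.inl i)) =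
      truncX k m i := by
    intro i
    rw [truncX]
    split_ifs with h
    · have := MvPolynomial.killCompl_rename_app (R := ℤ) e.injective
        (MvPolynomial.X (Sum.inl ⟨i, h⟩))
      rwa [MvPolynomial.rename_X] at this
    · rw [MvPolynomial.killCompl, MvPolynomial.aeval_X, dif_neg]
      rintro ⟨j | j, hj⟩
      · exact h (Sum.inl_injective hj ▸ j.2)
      · cases hj
  have hy : ∀ b, MvPolynomial.killCompl (R := ℤ) e.injective (MvPolynomial.X (Sum.inr b)) =
      truncY k m b := by
    intro b
    rw [truncY]
    split_ifs with h
    · have := MvPolynomial.killCompl_rename_app (R := ℤ) e.injective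
        (MvPolynomial.X (Sum.inr ⟨b, h⟩))
      rwa [MvPolynomial.rename_X] at this
    · rw [MvPolynomial.killCompl, MvPolynomial.aeval_X, dif_neg]
      rintro ⟨j | j, hj⟩
      · cases hj
      · exact h (Sum.inr_injective hj ▸ j.2)
  simp only [tableauWeight, tableauProd, boxFactor, map_prod, map_add, hx, hy]

/-- Tableaux with large entries do not contribute to the super-Schur polynomial. -/
theorem tableauProd_trunc_eq_zero {k m : ℕ} {lam : YoungDiagram} (h : m + length lam ≤ k + 1)
    {T : SemistandardYoungTableau lam} (hT : T ∉ boundedTableaux k lam) :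
    tableauProd (truncX k m) (truncY k m) T = 0 := by
  rw [mem_boundedTableaux] at hT
  push Not at hT
  obtain ⟨i, j, hij, hk⟩ := hT
  have hi := lt_length_of_mem hij
  refine prod_eq_zero (i := (i, j)) hij ?_
  -- Here `i + 1 ≤ ℓ(λ)`, so `T i j + j - i ≥ k - i ≥ k + 1 - ℓ(λ) ≥ m`.
  rw [truncX, truncY, dif_neg (by dsimp only; omega), dif_neg (by dsimp only; omega), add_zero]

theorem superSchurFin_eq_tableauSum {k m : ℕ} {lam : YoungDiagram}
    (h : m + length lam ≤ k + 1) :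
    superSchurFin k m lam = ((tableauSum (truncX k m) (truncY k m) k lam :
      MvPolynomial (Fin k ⊕ Fin m) ℤ) : MvPowerSeries (Fin k ⊕ Fin m) ℤ) := by
  ext d
  have hcoeff : ∀ T : SemistandardYoungTableau lam,
      (tableauWeight T).coeff (Finsupp.embDomain
        (Function.Embedding.sumMap Fin.valEmbedding Fin.valEmbedding) d) =
          (tableauProd (truncX k m) (truncY k m) T).coeff d := by
    intro T
    rw [← killCompl_tableauWeight, MvPolynomial.coeff_killCompl, Finsupp.embDomain_eq_mapDomain]
  rw [superSchurFin, MvPowerSeries.coeff_killCompl, MvPolynomial.coeff_coe, tableauSum,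
    MvPolynomial.coeff_sum]
  change ∑ᶠ T : SemistandardYoungTableau lam, (tableauWeight T).coeff _ = _
  simp only [hcoeff]
  -- Truncation leaves only bounded tableaux in the support, so the coefficientwise sum is finite
  -- uniformly in `d`.
  refine finsum_eq_finsetSum_of_support_subset _ fun T hT => ?_
  by_contra hT'
  exact hT (by dsimp only; rw [tableauProd_trunc_eq_zero h hT', MvPolynomial.coeff_zero])

/-- A column of length `k + 1` admits no tableau with entries less than `k`. -/
theorem tableauSum_eq_zero {R : Type*} [CommRing R] (x y : ℕ → R) {k : ℕ} {lam : YoungDiagram}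
    (h : k < length lam) : tableauSum x y k lam = 0 := by
  have hmem : (k, 0) ∈ lam := YoungDiagram.mem_iff_lt_colLen.mpr h
  refine sum_eq_zero fun T hT => ?_
  have h1 := mem_boundedTableaux.mp hT _ _ hmem
  have h2 := row_le_entry T hmem
  omega

end SchurVariations

theorem proposition4p2 (k m : ℕ) (lam : YoungDiagram)
    (h : m + SchurVariations.length lam ≤ k + 1) :
    SchurVariations.superSchurFin k m lam =
      ((SchurVariations.killY k m (SchurVariations.doubleSchur k lam) :
        MvPolynomial (Fin k ⊕ Fin m) ℤ) : MvPowerSeries (Fin k ⊕ Fin m) ℤ) := by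
  rw [SchurVariations.superSchurFin_eq_tableauSum h]
  rcases le_or_gt (SchurVariations.length lam) k with hlam | hlam
  · rw [SchurVariations.killY_doubleSchur m hlam]
  -- Only `m = 0`, `ℓ(λ) = k + 1` occurs here, and both sides vanish.
  · rw [SchurVariations.tableauSum_eq_zero _ _ hlam, SchurVariations.doubleSchur,
      if_neg (not_le.mpr hlam), map_zero]
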